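/- Let $\mathcal V$ be a symmetric monoidal category (unit $I$, symmetry $\psi$) that is cocomplete and has internal Homs, let $\mathcal V_0\subseteq\mathcal V$ be a full monoidal subcategory, every object of which has a right dual, let $\mathcal C$ be a small monoidal category in which every object has a right dual, and let $F:\mathcal C\to\mathcal V_0$ be a (strong) monoidal functor, with structure isomorphisms $s_{C,D}:FC\otimes FD\to F(C\otimes D)$ and $f:I\to F(I_{\mathcal C})$. (Neither a symmetry on $\mathcal C$ nor strictness of $\mathcal C$ is assumed.) Here a right dual of $X$ is an object $X^\wedge$ with morphisms $\varepsilon:X\otimes X^\wedge\to I$ and $\eta:I\to X^\wedge\otimes X$ satisfying the triangle identities. Let $E=\mathrm{End}^\vee(F)=\int^{C\in\mathcal C}FC\otimes(FC)^\wedge$ be the coend in $\mathcal V$ of the functor $(C,C')\mapsto FC'\otimes(FC)^\wedge$, with universal dinatural family $\lambda_C:FC\otimes(FC)^\wedge\to E$. Then $E$ is a Hopf algebra in $\mathcal V$: there are morphisms $\Delta:E\to E\otimes E$, $\epsilon:E\to I$, $m:E\otimes E\to E$, $u:I\to E$ and $a:E\to E$ such that $(E,m,u)$ is an algebra (monoid),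 $(E,\Delta,\epsilon)$ is a coalgebra (comonoid), the two structures form a bialgebra, and $$m\circ(a\otimes E)\circ\Delta=u\circ\epsilon=m\circ(E\otimes a)\circ\Delta .$$ Omitting associativity and unit isomorphisms, the structure is given by the following formulas, for all objects $C,D$ of $\mathcal C$. 1. $\Delta\circ\lambda_C=(\lambda_C\otimes\lambda_C)\circ(FC\otimes\eta\otimes(FC)^\wedge)$ and $\epsilon\circ\lambda_C=\varepsilon$, where $\eta,\varepsilon$ belong to the duality of $FC$. 2. $m\circ(\lambda_C\otimes\lambda_D)=\lambda_{C\otimes D}\circ\bigl(s_{C,D}\otimes(s_{C,D}^{-1})^\wedge\bigr)\circ\sigma$, where $\sigma:FC\otimes(FC)^\wedge\otimes FD\otimes(FD)^\wedge\to FC\otimes FD\otimes(FD)^\wedge\otimes(FC)^\wedge$ is the symmetry of $\mathcal V$ and $(FD)^\wedge\otimes(FC)^\wedge$ is regarded as the right dual of $FC\otimes FD$. 3. $u=\lambda_{I_{\mathcal C}}\circ\bigl(f\otimes(f^{-1})^\wedge\bigr)$, where $I\cong I\otimes I$ and $I^\wedge=I$. 4. The antipode $a$ is induced by the symmetry: $a\circ\lambda_C$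 is the composite $$FC\otimes(FC)^\wedge\cong FC\otimes F(C^\wedge)\xrightarrow{\ \psi\ }F(C^\wedge)\otimes FC\cong F(C^\wedge)\otimes F(C^\wedge)^\wedge\xrightarrow{\ \lambda_{C^\wedge}\ }E .$$ Here $(FC)^\wedge\cong F(C^\wedge)$ is the canonical isomorphism between right duals of $FC$ ($F$ preserves dualities), and $FC\cong F(C^\wedge)^\wedge$ is the canonical isomorphism between right duals of $F(C^\wedge)$ (by the symmetry of $\mathcal V$, the duality between $FC$ and $F(C^\wedge)$ also makes $FC$ a right dual of $F(C^\wedge)$). -/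

import Mathlib

open CategoryTheory MonoidalCategory Limits Opposite

/-!
Conventions.  A right dual of an object `X` is an object `X^∧` with morphisms
`ε : X ⊗ X^∧ ⟶ 𝟙_` and `η : 𝟙_ ⟶ X^∧ ⊗ X` satisfying the two triangle identities.  This is
`ExactPairing X^∧ X` in Mathlib, which writes `ᘁX` for `X^∧` and uses the word "left" for it
(`HasLeftDual`, `LeftRigidCategory`, `leftAdjointMate`); `ᘁf : ᘁY ⟶ ᘁX` is the dual morphism `f^∧`.
-/

universe w w' v u

namespace PredualEnd

section Coend

variable {C : Type w} [Category.{w'} C] {V : Type u} [Category.{v} V] [MonoidalCategory V]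

/-- The bifunctor `(C, C') ↦ F C' ⊗ (F C)^∧`, contravariant in `C`, covariant in `C'`. -/
@[simps]
def bifunctor (F : C ⥤ V) [∀ X : C, HasLeftDual (F.obj X)] : Cᵒᵖ ⥤ C ⥤ V where
  obj X :=
    { obj := fun Y => F.obj Y ⊗ (ᘁ(F.obj X.unop) : V)
      map := fun g => F.map g ▷ (ᘁ(F.obj X.unop) : V) }
  map f :=
    { app := fun Y => F.obj Y ◁ (ᘁ(F.map f.unop))
      naturality := fun _ _ g => (whisker_exchange (F.map g) (ᘁ(F.map f.unop))).symm }
  map_id X := by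
    ext Y
    simp
  map_comp f g := by
    ext Y
    simp [comp_leftAdjointMate]

variable (F : C ⥤ V) [∀ X : C, HasLeftDual (F.obj X)] [HasCoend (bifunctor F)]

/-- `End^∨(F) = ∫^C F C ⊗ (F C)^∧`. -/
noncomputable def EndPredual : V := coend (bifunctor F)

/-- The universal dinatural family `λ_C : F C ⊗ (F C)^∧ ⟶ End^∨(F)`. -/
noncomputable def incl (X : C) : F.obj X ⊗ (ᘁ(F.obj X) : V) ⟶ EndPredual F :=
  coend.ι (bifunctor F) X

/-- `F C ⊗ (F C)^∧ ⟶ (F C ⊗ (F C)^∧) ⊗ (F C ⊗ (F C)^∧) ⟶ End^∨(F) ⊗ End^∨(F)`: insert the unit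
`η : 𝟙_ ⟶ (F C)^∧ ⊗ F C` in the middle, then apply `λ_C ⊗ λ_C`. -/
noncomputable def comulComponent (X : C) :
    F.obj X ⊗ (ᘁ(F.obj X) : V) ⟶ EndPredual F ⊗ EndPredual F :=
  (ρ_ (F.obj X)).inv ▷ (ᘁ(F.obj X) : V) ≫
    (F.obj X ◁ η_ (ᘁ(F.obj X) : V) (F.obj X)) ▷ (ᘁ(F.obj X) : V) ≫
    (α_ (F.obj X) (ᘁ(F.obj X) : V) (F.obj X)).inv ▷ (ᘁ(F.obj X) : V) ≫
    (α_ (F.obj X ⊗ (ᘁ(F.obj X) : V)) (F.obj X) (ᘁ(F.obj X) : V)).hom ≫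
    (incl F X ⊗ₘ incl F X)

/-- The counit `ε : F C ⊗ (F C)^∧ ⟶ 𝟙_` of the duality of `F C`. -/
def counitComponent (X : C) : F.obj X ⊗ (ᘁ(F.obj X) : V) ⟶ 𝟙_ V :=
  ε_ (ᘁ(F.obj X) : V) (F.obj X)

end Coend

section Tensor

variable {C : Type w} [Category.{w'} C] [MonoidalCategory C]
  {V : Type u} [Category.{v} V] [MonoidalCategory V]
  (F : C ⥤ V) [F.Monoidal]

/-- A tensor functor carries a duality between `X` and `Y` to a duality between `F X` and `F Y`,
with unit and counit the images under `F` of the given ones. -/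
abbrev mapPairing (X Y : C) [ExactPairing X Y] : ExactPairing (F.obj X) (F.obj Y) where
  coevaluation' := Functor.LaxMonoidal.ε F ≫ F.map (η_ X Y) ≫ Functor.OplaxMonoidal.δ F X Y
  evaluation' := Functor.LaxMonoidal.μ F Y X ≫ F.map (ε_ X Y) ≫ Functor.OplaxMonoidal.η F
  coevaluation_evaluation' := by
    have h := congrArg F.map (ExactPairing.coevaluation_evaluation X Y)
    simp only [Functor.map_comp, Functor.Monoidal.map_whiskerLeft,
      Functor.Monoidal.map_associator_inv, Functor.Monoidal.map_whiskerRight,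
      Functor.Monoidal.map_rightUnitor, Functor.Monoidal.map_leftUnitor_inv, Category.assoc,
      Functor.Monoidal.μ_δ_assoc] at h
    rw [cancel_epi, ← cancel_epi (F.obj Y ◁ Functor.LaxMonoidal.ε F)] at h
    rw [← cancel_mono (Functor.LaxMonoidal.ε F ▷ F.obj Y ≫ Functor.LaxMonoidal.μ F (𝟙_ C) Y)]
    simpa using h
  evaluation_coevaluation' := by
    have h := congrArg F.map (ExactPairing.evaluation_coevaluation X Y)
    simp only [Functor.map_comp, Functor.Monoidal.map_whiskerLeft,
      Functor.Monoidal.map_associator, Functor.Monoidal.map_whiskerRight,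
      Functor.Monoidal.map_leftUnitor, Functor.Monoidal.map_rightUnitor_inv, Category.assoc,
      Functor.Monoidal.μ_δ_assoc] at h
    rw [cancel_epi, ← cancel_epi (Functor.LaxMonoidal.ε F ▷ F.obj X)] at h
    rw [← cancel_mono (F.obj X ◁ Functor.LaxMonoidal.ε F ≫ Functor.LaxMonoidal.μ F X (𝟙_ C))]
    simpa using h

variable [∀ X : C, HasLeftDual (F.obj X)]

/-- `(s_{C,D}⁻¹)^∧ : (F D)^∧ ⊗ (F C)^∧ ⟶ (F (C ⊗ D))^∧`, where `(F D)^∧ ⊗ (F C)^∧` is regarded as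
the dual of `F C ⊗ F D` and `s_{C,D} : F C ⊗ F D ≅ F (C ⊗ D)` is the structure of `F`. -/
def dualTensorComparison (X Y : C) :
    (ᘁ(F.obj Y) : V) ⊗ (ᘁ(F.obj X) : V) ⟶ (ᘁ(F.obj (X ⊗ Y)) : V) :=
  @leftAdjointMate V _ _ (F.obj (X ⊗ Y)) (F.obj X ⊗ F.obj Y) _ hasLeftDualTensor
    (Functor.OplaxMonoidal.δ F X Y)

/-- `(f⁻¹)^∧ : 𝟙_ ⟶ (F 𝟙_)^∧`, where `𝟙_` is regarded as its own dual and `f : 𝟙_ ≅ F 𝟙_` is the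
structure of `F`. -/
def dualUnitComparison : 𝟙_ V ⟶ (ᘁ(F.obj (𝟙_ C)) : V) :=
  @leftAdjointMate V _ _ (F.obj (𝟙_ C)) (𝟙_ V) _ hasLeftDualUnit (Functor.OplaxMonoidal.η F)

/-- `𝟙_ ≅ 𝟙_ ⊗ 𝟙_ ⟶ F 𝟙_ ⊗ (F 𝟙_)^∧ ⟶ End^∨(F)`, given by `f ⊗ (f⁻¹)^∧` followed by `λ_{𝟙_}`. -/
noncomputable def unitMap [HasCoend (bifunctor F)] : 𝟙_ V ⟶ EndPredual F :=
  (λ_ (𝟙_ V)).inv ≫ (Functor.LaxMonoidal.ε F ⊗ₘ dualUnitComparison F) ≫ incl F (𝟙_ C)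

/-- The canonical isomorphism `(F C)^∧ ≅ F (C^∧)` between two right duals of `F C`. -/
def dualIso [LeftRigidCategory C] (X : C) : (ᘁ(F.obj X) : V) ≅ F.obj (ᘁX : C) :=
  leftDualIso (Y := F.obj X) HasLeftDual.exact (mapPairing F (ᘁX : C) X)

variable [SymmetricCategory V] [HasCoend (bifunctor F)]

/-- `(F C ⊗ (F C)^∧) ⊗ (F D ⊗ (F D)^∧) ⟶ (F C ⊗ F D) ⊗ ((F D)^∧ ⊗ (F C)^∧)` (symmetry), followed by
`s_{C,D} ⊗ (s_{C,D}⁻¹)^∧` and by `λ_{C ⊗ D}`. -/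
noncomputable def mulComponent (X Y : C) :
    (F.obj X ⊗ (ᘁ(F.obj X) : V)) ⊗ (F.obj Y ⊗ (ᘁ(F.obj Y) : V)) ⟶ EndPredual F :=
  tensorμ (F.obj X) (ᘁ(F.obj X) : V) (F.obj Y) (ᘁ(F.obj Y) : V) ≫
    (F.obj X ⊗ F.obj Y) ◁ (β_ (ᘁ(F.obj X) : V) (ᘁ(F.obj Y) : V)).hom ≫
    (Functor.LaxMonoidal.μ F X Y ⊗ₘ dualTensorComparison F X Y) ≫ incl F (X ⊗ Y)

variable [LeftRigidCategory C]

/-- The canonical isomorphism `F C ≅ (F (C^∧))^∧`: by symmetry of `V`, the duality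
between `F C` and its right dual `F (C^∧)` also makes `F C` a right dual of `F (C^∧)`. -/
def doubleDualIso (X : C) : F.obj X ≅ (ᘁ(F.obj (ᘁX : C)) : V) :=
  leftDualIso (Y := F.obj (ᘁX : C))
    (@BraidedCategory.exactPairing_swap V _ _ _ (F.obj (ᘁX : C)) (F.obj X)
      (mapPairing F (ᘁX : C) X))
    HasLeftDual.exact

/-- `F C ⊗ (F C)^∧ ≅ F C ⊗ F (C^∧) ⟶ F (C^∧) ⊗ F C ≅ F (C^∧) ⊗ (F (C^∧))^∧ ⟶ End^∨(F)`, where the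
middle arrow is the symmetry `ψ` and the last one is `λ_{C^∧}`. -/
noncomputable def antipodeComponent (X : C) :
    F.obj X ⊗ (ᘁ(F.obj X) : V) ⟶ EndPredual F :=
  F.obj X ◁ (dualIso F X).hom ≫ (β_ (F.obj X) (F.obj (ᘁX : C))).hom ≫
    F.obj (ᘁX : C) ◁ (doubleDualIso F X).hom ≫ incl F (ᘁX : C)

end Tensor

section Subcategory

variable {C : Type w} [Category.{w'} C] {V : Type u} [Category.{v} V] [MonoidalCategory V]

/-- A functor into a full subcategory all of whose objects have right duals in `V`, regarded as a
functor into `V`, takes values in objects with right duals. -/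
instance hasLeftDualObj (P : ObjectProperty V) [h : ∀ A : P.FullSubcategory, HasLeftDual A.obj]
    (F : C ⥤ P.FullSubcategory) (X : C) : HasLeftDual ((F ⋙ P.ι).obj X) :=
  h (F.obj X)

end Subcategory

end PredualEnd

open PredualEnd

/-! Write E for End^∨(F). Transposing λ_C across the duality of FC gives a coaction FC ⟶ E ⊗ FC
(`coact`), and dinaturality of λ becomes naturality in C. The coend property then says that a
morphism E ⟶ M is the same as a natural family FC ⟶ M ⊗ FC. As V is closed, this persists with a
parameter N tensored on the left (`exists_lift`, `separating_coact`); using it twice treats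
morphisms out of E ⊗ E (`exists_tensor_lift`, `Separating.tensor`).

The structure maps are thus determined by coactions: Δ by coacting twice, the counit by the trivial
coaction, m by the coaction on F(C ⊗ D) moved to FC ⊗ FD, u by the coaction on the image of the
unit, and a by the coaction on FC dual to that on F(C^∧). Every axiom becomes an equality of
coactions. The monoid axioms follow from coherence of F, and multiplicativity of Δ from
`tensorCoaction_seqCoaction`. For the antipode, the unit and counit of the duality of C are
morphisms of C, so their images under F commute with the coactions; a triangle identity finishes.
Transposing back gives the explicit formulas. -/

namespace PredualEnd

/-! ### Coactions in a braided category: iteration and tensor product. -/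

section Coaction

variable {V : Type u} [Category.{v} V] [MonoidalCategory V] {A B M M' N T T' : V}

/-- Perform two coactions on the same object in succession. -/
def seqCoaction (d : A ⟶ M ⊗ A) (d' : A ⟶ M' ⊗ A) : A ⟶ (M ⊗ M') ⊗ A :=
  d ≫ M ◁ d' ≫ (α_ M M' A).inv

/-- Let a coaction on `A` act on `A ⊗ B`. -/
def coactRight (d : A ⟶ M ⊗ A) (B : V) : A ⊗ B ⟶ M ⊗ A ⊗ B :=
  d ▷ B ≫ (α_ M A B).hom

variable [BraidedCategory V]

/-- Let a coaction on `A` act on `B ⊗ A`. -/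
def coactLeft (B : V) (d : A ⟶ M ⊗ A) : B ⊗ A ⟶ M ⊗ B ⊗ A :=
  B ◁ d ≫ (α_ B M A).inv ≫ (β_ B M).hom ▷ A ≫ (α_ M B A).hom

/-- The tensor product of two coactions. -/
def tensorCoaction (d : A ⟶ M ⊗ A) (e : B ⟶ N ⊗ B) : A ⊗ B ⟶ (M ⊗ N) ⊗ A ⊗ B :=
  (d ⊗ₘ e) ≫ tensorμ M A N B

lemma tensorCoaction_eq_seqCoaction (d : A ⟶ M ⊗ A) (e : B ⟶ N ⊗ B) :
    tensorCoaction d e = seqCoaction (coactRight d B) (coactLeft A e) := by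
  simp only [tensorCoaction, seqCoaction, coactRight, coactLeft, tensorμ,
    MonoidalCategory.tensorHom_def]
  monoidal

lemma tensorCoaction_comp_whiskerRight (d : A ⟶ M ⊗ A) (e : B ⟶ N ⊗ B) (f : M ⟶ T) (g : N ⟶ T') :
    tensorCoaction (d ≫ f ▷ A) (e ≫ g ▷ B) = tensorCoaction d e ≫ (f ⊗ₘ g) ▷ (A ⊗ B) := by
  have h := tensorμ_natural f (𝟙 A) g (𝟙 B)
  rw [tensorHom_id, tensorHom_id, id_tensorHom_id, tensorHom_id] at h
  simp only [tensorCoaction, Category.assoc]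
  rw [← h, tensorHom_comp_tensorHom_assoc]

/-- Coherence of `tensorμ` with associators, plus its naturality. On coactions, this is the
bialgebra compatibility of Δ and m. -/
lemma tensorCoaction_seqCoaction (d : A ⟶ M ⊗ A) (d' : A ⟶ M' ⊗ A) (e : B ⟶ N ⊗ B)
    (e' : B ⟶ T ⊗ B) :
    tensorCoaction (seqCoaction d d') (seqCoaction e e') ≫ tensorμ M M' N T ▷ (A ⊗ B) =
      seqCoaction (tensorCoaction d e) (tensorCoaction d' e') := by
  rw [← cancel_mono (α_ _ _ _).hom]
  simp only [tensorCoaction, seqCoaction, Category.assoc, associator_monoidal, Iso.inv_hom_id,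
    Category.comp_id, MonoidalCategory.whiskerLeft_comp]
  rw [tensorHom_comp_tensorHom_assoc]
  simp only [Category.assoc, Iso.inv_hom_id, Category.comp_id]
  rw [← tensorHom_comp_tensorHom_assoc]
  have h := tensorμ_natural (𝟙 M) d' (𝟙 N) e'
  simp only [id_tensorHom] at h
  rw [reassoc_of% h]
  simp

lemma tensorCoaction_assoc (d : A ⟶ M ⊗ A) (e : B ⟶ N ⊗ B) {D : V} (k : D ⟶ T ⊗ D) :
    tensorCoaction (tensorCoaction d e) k ≫ (α_ M N T).hom ▷ ((A ⊗ B) ⊗ D) =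
      (α_ A B D).hom ≫ tensorCoaction d (tensorCoaction e k) ≫ _ ◁ (α_ A B D).inv := by
  have h := tensor_associativity M A N B T D
  rw [MonoidalCategory.tensorHom_def (α_ M N T).hom] at h
  have h₁ : (d ⊗ₘ e) ≫ tensorμ M A N B ⊗ₘ k =
      ((d ⊗ₘ e) ⊗ₘ k) ≫ tensorμ M A N B ▷ (T ⊗ D) := by
    rw [← tensorHom_id, tensorHom_comp_tensorHom, Category.comp_id]
  have h₂ : d ⊗ₘ ((e ⊗ₘ k) ≫ tensorμ N B T D) =
      (d ⊗ₘ (e ⊗ₘ k)) ≫ (M ⊗ A) ◁ tensorμ N B T D := by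
    rw [← id_tensorHom, tensorHom_comp_tensorHom, Category.comp_id]
  rw [← cancel_mono ((M ⊗ N ⊗ T) ◁ (α_ A B D).hom)]
  simp only [Category.assoc, whiskerLeft_inv_hom, Category.comp_id]
  simp only [tensorCoaction]
  rw [h₁, h₂]
  simp only [Category.assoc]
  rw [h, associator_naturality_assoc]

lemma coactLeft_seqCoaction (X : V) (d : A ⟶ M ⊗ A) (d' : A ⟶ M' ⊗ A) :
    coactLeft X (seqCoaction d d') = seqCoaction (coactLeft X d) (coactLeft X d') := by
  simp only [coactLeft, seqCoaction, BraidedCategory.braiding_tensor_right_hom]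
  calc
    _ = X ◁ d ⊗≫ ((X ⊗ M) ◁ d' ≫ (β_ X M).hom ▷ (M' ⊗ A)) ⊗≫ M ◁ (β_ X M').hom ▷ A ⊗≫ 𝟙 _ := by
      monoidal
    _ = _ := by
      rw [whisker_exchange]
      monoidal

lemma coactLeft_coactLeft (X Y : V) (d : A ⟶ M ⊗ A) :
    coactLeft X (coactLeft Y d) = (α_ X Y A).inv ≫ coactLeft (X ⊗ Y) d ≫ M ◁ (α_ X Y A).hom := by
  simp only [coactLeft, BraidedCategory.braiding_tensor_left_hom]
  monoidal

lemma coactLeft_natural {X Y : V} (f : X ⟶ Y) (d : A ⟶ M ⊗ A) :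
    f ▷ A ≫ coactLeft Y d = coactLeft X d ≫ M ◁ f ▷ A := by
  simp only [coactLeft, ← whisker_exchange_assoc, Category.assoc]
  rw [associator_inv_naturality_left_assoc, ← comp_whiskerRight_assoc,
    BraidedCategory.braiding_naturality_left]
  simp

lemma coactLeft_unit (d : A ⟶ M ⊗ A) :
    coactLeft (𝟙_ V) d = (λ_ A).hom ≫ d ≫ M ◁ (λ_ A).inv := by
  simp [coactLeft, braiding_tensorUnit_left]

end Coaction

/-! ### Coactions and the symmetry. -/

section Symmetric

variable {V : Type u} [Category.{v} V] [MonoidalCategory V] [SymmetricCategory V] {A B T T' : V}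

/-- Pulling `e` through the first braiding leaves two double crossings, of `A` with `T` and of `A`
with `B`; these cancel by symmetry. -/
lemma braiding_coactLeft (A : V) (e : B ⟶ T ⊗ B) :
    (β_ B A).hom ≫ coactLeft A e ≫ T ◁ (β_ A B).hom = coactRight e A := by
  rw [coactLeft, ← Category.assoc, ← Category.assoc, ← BraidedCategory.braiding_naturality_left]
  simp only [BraidedCategory.braiding_tensor_left_hom, coactRight, Category.assoc,
    Iso.hom_inv_id_assoc, ← comp_whiskerRight_assoc, SymmetricCategory.symmetry]
  simp only [id_whiskerRight, Category.id_comp, Iso.inv_hom_id_assoc,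
    ← MonoidalCategory.whiskerLeft_comp, SymmetricCategory.symmetry,
    MonoidalCategory.whiskerLeft_id, Category.comp_id]

/-- Sliding two coactions past one another. -/
lemma tensorCoaction_swap (d : A ⟶ T ⊗ A) (e : B ⟶ T' ⊗ B) :
    B ◁ d ≫ (α_ B T A).inv ≫ (β_ B T).hom ▷ A ≫ (T ◁ e ≫ (α_ T T' B).inv) ▷ A =
      (β_ B A).hom ≫ tensorCoaction d e ≫ (T ⊗ T') ◁ (β_ A B).hom ≫ (α_ (T ⊗ T') B A).inv := by
  have h : (β_ B A).hom ≫ coactRight d B = coactLeft B d ≫ T ◁ (β_ B A).hom := by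
    rw [← braiding_coactLeft B d]
    simp [SymmetricCategory.symmetry_assoc]
  rw [tensorCoaction_eq_seqCoaction]
  simp only [seqCoaction, Category.assoc]
  rw [reassoc_of% h, ← associator_inv_naturality_right_assoc,
    ← MonoidalCategory.whiskerLeft_comp_assoc, ← MonoidalCategory.whiskerLeft_comp_assoc,
    Category.assoc, braiding_coactLeft]
  simp only [coactLeft, coactRight]
  monoidal

end Symmetric

/-! ### Transposition across a duality. -/

section Duality

variable {V : Type u} [Category.{v} V] [MonoidalCategory V]

/-- The coevaluations exchange a morphism with its mate. This turns dinaturality of λ into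
naturality of the coaction, and later removes the dual morphisms from the formulas for m and u. -/
lemma tensorRightHomEquiv_whiskerLeft_leftAdjointMate {S T : V} [HasLeftDual S] [HasLeftDual T]
    (f : S ⟶ T) {X M : V} (p : X ⊗ (ᘁS : V) ⟶ M) :
    tensorRightHomEquiv X (ᘁT : V) T M (X ◁ (ᘁf) ≫ p) =
      tensorRightHomEquiv X (ᘁS : V) S M p ≫ M ◁ f := by
  simp only [tensorRightHomEquiv, Equiv.coe_fn_mk, Category.assoc, comp_whiskerRight]
  rw [← associator_inv_naturality_middle_assoc, ← MonoidalCategory.whiskerLeft_comp_assoc,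
    coevaluation_comp_leftAdjointMate, ← whisker_exchange]
  simp

lemma tensorRightHomEquiv_whiskerLeft {A A' X M N P : V} [ExactPairing A' A] (p : X ⊗ A' ⟶ M)
    (h : N ⊗ M ⟶ P) :
    tensorRightHomEquiv (N ⊗ X) A' A P ((α_ N X A').hom ≫ N ◁ p ≫ h) =
      N ◁ tensorRightHomEquiv X A' A M p ≫ (α_ N M A).inv ≫ h ▷ A := by
  simp only [tensorRightHomEquiv, Equiv.coe_fn_mk]
  monoidal

variable [BraidedCategory V]

/-- The evaluation of `A ⊗ B` nests the pair `B, B'` inside `A, A'`; naturality of the braiding of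
`A'` against the inner evaluation pulls that pair out. -/
lemma tensorμ_comp_tensor_evaluation (A A' B B' : V) [ExactPairing A' A] [ExactPairing B' B] :
    tensorμ A A' B B' ≫ (A ⊗ B) ◁ (β_ A' B').hom ≫ ε_ (B' ⊗ A') (A ⊗ B) =
      (ε_ A' A ⊗ₘ ε_ B' B) ≫ (λ_ (𝟙_ V)).hom := by
  have h := BraidedCategory.braiding_naturality_right A' (ε_ B' B)
  rw [BraidedCategory.braiding_tensor_right_hom, braiding_tensorUnit_right] at h
  rw [ExactPairing.tensor_evaluation, tensorμ]
  calc
    _ = 𝟙 _ ⊗≫ A ◁ (((α_ A' B B').inv ≫ (β_ A' B).hom ▷ B' ≫ (α_ B A' B').hom ≫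
        B ◁ (β_ A' B').hom ≫ (α_ B B' A').inv) ≫ ε_ B' B ▷ A') ⊗≫ ε_ A' A := by monoidal
    _ = 𝟙 _ ⊗≫ ((A ⊗ A') ◁ ε_ B' B ≫ ε_ A' A ▷ 𝟙_ V) ⊗≫ 𝟙 _ := by rw [← h]; monoidal
    _ = _ := by rw [whisker_exchange, MonoidalCategory.tensorHom_def]; monoidal

lemma tensorRightHomEquiv_symm_tensorCoaction {A A' B B' M N : V} [ExactPairing A' A]
    [ExactPairing B' B] (d : A ⟶ M ⊗ A) (e : B ⟶ N ⊗ B) :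
    tensorμ A A' B B' ≫ (A ⊗ B) ◁ (β_ A' B').hom ≫
        (tensorRightHomEquiv (A ⊗ B) (B' ⊗ A') (A ⊗ B) (M ⊗ N)).symm (tensorCoaction d e) =
      ((tensorRightHomEquiv A A' A M).symm d ⊗ₘ (tensorRightHomEquiv B B' B N).symm e) := by
  have h := tensorμ_natural d (𝟙 A') e (𝟙 B')
  rw [tensorHom_id, tensorHom_id, id_tensorHom_id, tensorHom_id] at h
  have h₁ := tensorμ_natural (𝟙 M) (ε_ A' A) (𝟙 N) (ε_ B' B)
  rw [id_tensorHom, id_tensorHom, id_tensorHom_id, id_tensorHom] at h₁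
  have h₂ := rightUnitor_monoidal M N
  simp only [tensorRightHomEquiv, Equiv.coe_fn_symm_mk, tensorCoaction]
  rw [whisker_exchange_assoc, comp_whiskerRight_assoc, ← reassoc_of% h]
  rw [associator_naturality_right_assoc, associator_monoidal_assoc,
    ← MonoidalCategory.whiskerLeft_comp_assoc, ← MonoidalCategory.whiskerLeft_comp_assoc,
    Category.assoc, tensorμ_comp_tensor_evaluation, MonoidalCategory.whiskerLeft_comp_assoc,
    ← reassoc_of% h₁, ← h₂]
  simp only [tensorHom_comp_tensorHom]

end Duality

/-! ### Coactions that detect equality of morphisms. -/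

section Separating

variable {V : Type u} [Category.{v} V] [MonoidalCategory V]

/-- A family of coactions of `T` is separating if morphisms out of `N ⊗ T` are determined by their
composites with the coactions. -/
def Separating {ι : Type w} {T : V} {A : ι → V} (d : ∀ i, A i ⟶ T ⊗ A i) : Prop :=
  ∀ ⦃N M : V⦄ (f g : N ⊗ T ⟶ M),
    (∀ i, N ◁ d i ≫ (α_ N T (A i)).inv ≫ f ▷ A i = N ◁ d i ≫ (α_ N T (A i)).inv ≫ g ▷ A i) → f = g

lemma Separating.hom_ext {ι : Type w} {T : V} {A : ι → V} {d : ∀ i, A i ⟶ T ⊗ A i}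
    (hd : Separating d) {M : V} {f g : T ⟶ M} (h : ∀ i, d i ≫ f ▷ A i = d i ≫ g ▷ A i) : f = g := by
  rw [← cancel_epi (λ_ T).hom]
  refine hd _ _ fun i => ?_
  simp only [comp_whiskerRight, leftUnitor_whiskerRight, Iso.inv_hom_id_assoc,
    Category.assoc]
  rw [leftUnitor_naturality_assoc, leftUnitor_naturality_assoc, h]

/-- Test against `e` with parameter `N ⊗ T`, then against `d` with parameter `N ⊗ B j`. This is why
`Separating` allows an arbitrary `N`. -/
lemma Separating.tensor {V : Type u} [Category.{v} V] [MonoidalCategory V] [SymmetricCategory V]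
    {ι : Type w} {κ : Type w'} {T T' : V} {A : ι → V} {B : κ → V}
    {d : ∀ i, A i ⟶ T ⊗ A i} {e : ∀ j, B j ⟶ T' ⊗ B j} (hd : Separating d) (he : Separating e) :
    Separating (fun p : ι × κ => tensorCoaction (d p.1) (e p.2)) := by
  intro N M f g h
  rw [← cancel_epi (α_ N T T').hom]
  refine he _ _ fun j => ?_
  -- The symmetry brings `T` to the last place, where `d` can be tested.
  rw [← cancel_epi ((α_ N (B j) T).hom ≫ N ◁ (β_ (B j) T).hom ≫ (α_ N T (B j)).inv)]
  refine hd _ _ fun i => ?_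
  have key : ∀ k : N ⊗ T ⊗ T' ⟶ M,
      (N ⊗ B j) ◁ d i ≫ (α_ (N ⊗ B j) T (A i)).inv ≫
        (((α_ N (B j) T).hom ≫ N ◁ (β_ (B j) T).hom ≫ (α_ N T (B j)).inv) ≫
          (N ⊗ T) ◁ e j ≫ (α_ (N ⊗ T) T' (B j)).inv ≫ ((α_ N T T').hom ≫ k) ▷ B j) ▷ A i =
      (α_ N (B j) (A i)).hom ≫ N ◁ (β_ (B j) (A i)).hom ≫
        (N ◁ tensorCoaction (d i) (e j) ≫ (α_ N (T ⊗ T') (A i ⊗ B j)).inv ≫ k ▷ (A i ⊗ B j)) ≫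
        M ◁ (β_ (A i) (B j)).hom ≫ (α_ M (B j) (A i)).inv := by
    intro k
    calc
      _ = 𝟙 _ ⊗≫ N ◁ (B j ◁ d i ≫ (α_ (B j) T (A i)).inv ≫ (β_ (B j) T).hom ▷ A i ≫
          (T ◁ e j ≫ (α_ T T' (B j)).inv) ▷ A i) ⊗≫ k ▷ B j ▷ A i := by monoidal
      _ = 𝟙 _ ⊗≫ N ◁ ((β_ (B j) (A i)).hom ≫ tensorCoaction (d i) (e j)) ⊗≫
          ((N ⊗ (T ⊗ T')) ◁ (β_ (A i) (B j)).hom ≫ k ▷ (B j ⊗ A i)) ⊗≫ 𝟙 _ := by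
        rw [tensorCoaction_swap]; monoidal
      _ = _ := by rw [whisker_exchange]; monoidal
  rw [key, key, h (i, j)]

end Separating

/-! ### The coend property in terms of coactions. -/

section Coend

variable {C : Type w} [Category.{w'} C] {V : Type u} [Category.{v} V] [MonoidalCategory V]
  (F : C ⥤ V) [∀ X : C, HasLeftDual (F.obj X)] [HasCoend (bifunctor F)]

lemma incl_dinatural {X Y : C} (g : X ⟶ Y) :
    F.obj X ◁ (ᘁ(F.map g)) ≫ incl F X = F.map g ▷ (ᘁ(F.obj Y) : V) ≫ incl F Y :=
  coend.condition (bifunctor F) g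

/-- The universal coaction `F C ⟶ End^∨(F) ⊗ F C`. -/
noncomputable def coact (X : C) : F.obj X ⟶ EndPredual F ⊗ F.obj X :=
  tensorRightHomEquiv _ _ _ _ (incl F X)

lemma coact_natural {X Y : C} (g : X ⟶ Y) :
    F.map g ≫ coact F Y = coact F X ≫ EndPredual F ◁ F.map g := by
  rw [coact, coact, ← tensorRightHomEquiv_whiskerLeft_leftAdjointMate, incl_dinatural,
    ← (tensorRightHomEquiv _ (ᘁ(F.obj Y) : V) _ _).symm.injective.eq_iff,
    tensorRightHomEquiv_symm_naturality]
  simp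

variable [MonoidalClosed V]

/-- Currying moves `N` into the target, so extensionality for the coend applies; each component is
then transposed. -/
lemma separating_coact : Separating (coact F) := by
  intro N M f g h
  apply MonoidalClosed.curry_injective
  refine coend.hom_ext fun X => ?_
  change incl F X ≫ _ = incl F X ≫ _
  rw [← MonoidalClosed.curry_natural_left, ← MonoidalClosed.curry_natural_left]
  congr 1
  rw [← cancel_epi (α_ _ _ _).hom, ← (tensorRightHomEquiv _ _ (F.obj X) _).injective.eq_iff,
    tensorRightHomEquiv_whiskerLeft, tensorRightHomEquiv_whiskerLeft]
  exact h X

/-- Transposed and curried, `φ` is a family into the internal Hom from `N` to `M`, and its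
naturality is the dinaturality needed to descend to the coend. -/
lemma exists_lift {N M : V} (φ : ∀ X, N ⊗ F.obj X ⟶ M ⊗ F.obj X)
    (hφ : ∀ ⦃X Y : C⦄ (g : X ⟶ Y), N ◁ F.map g ≫ φ Y = φ X ≫ M ◁ F.map g) :
    ∃ h : N ⊗ EndPredual F ⟶ M,
      ∀ X, N ◁ coact F X ≫ (α_ N (EndPredual F) (F.obj X)).inv ≫ h ▷ F.obj X = φ X := by
  let p (X : C) := (α_ N (F.obj X) (ᘁ(F.obj X) : V)).inv ≫ (tensorRightHomEquiv _ _ _ _).symm (φ X)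
  let k : EndPredual F ⟶ (ihom N).obj M := coend.desc (F := bifunctor F)
    (fun X => MonoidalClosed.curry (p X)) (by
      intro X Y g
      dsimp only [bifunctor]
      erw [← MonoidalClosed.curry_natural_left, ← MonoidalClosed.curry_natural_left]
      congr 1
      simp only [p]
      rw [associator_inv_naturality_right_assoc, associator_inv_naturality_middle_assoc]
      congr 1
      rw [← tensorRightHomEquiv_symm_naturality, hφ, Equiv.eq_symm_apply,
        tensorRightHomEquiv_whiskerLeft_leftAdjointMate, Equiv.apply_symm_apply]
      rfl)
  have hk (X : C) : incl F X ≫ k = MonoidalClosed.curry (p X) := coend.ι_desc _ _ _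
  refine ⟨MonoidalClosed.uncurry k, fun X => ?_⟩
  rw [coact, ← tensorRightHomEquiv_whiskerLeft, ← MonoidalClosed.uncurry_natural_left, hk,
    MonoidalClosed.uncurry_curry]
  simp [p]

lemma exists_lift_of_natural {M : V} (φ : ∀ X, F.obj X ⟶ M ⊗ F.obj X)
    (hφ : ∀ ⦃X Y : C⦄ (g : X ⟶ Y), F.map g ≫ φ Y = φ X ≫ M ◁ F.map g) :
    ∃ h : EndPredual F ⟶ M, ∀ X, coact F X ≫ h ▷ F.obj X = φ X := by
  obtain ⟨h, hh⟩ := exists_lift F (N := 𝟙_ V) (fun X => (λ_ _).hom ≫ φ X) (by simp [hφ])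
  refine ⟨(λ_ _).inv ≫ h, fun X => ?_⟩
  rw [← cancel_epi (λ_ _).hom, ← hh]
  simp

end Coend

/-! ### Morphisms out of E ⊗ E. -/

section TensorLift

variable {C : Type w} [Category.{w'} C] {V : Type u} [Category.{v} V] [MonoidalCategory V]
  [SymmetricCategory V] [MonoidalClosed V]
  (F : C ⥤ V) [∀ X : C, HasLeftDual (F.obj X)] [HasCoend (bifunctor F)]

/-- Lift in one variable at a time: first in `X` with parameter `F.obj Y`, then in `Y` with
parameter E. -/
lemma exists_tensor_lift {M : V} (φ : ∀ X Y, F.obj X ⊗ F.obj Y ⟶ M ⊗ F.obj X ⊗ F.obj Y)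
    (hl : ∀ ⦃X X' : C⦄ (g : X ⟶ X') (Y : C),
      F.map g ▷ F.obj Y ≫ φ X' Y = φ X Y ≫ M ◁ F.map g ▷ F.obj Y)
    (hr : ∀ (X : C) ⦃Y Y' : C⦄ (g : Y ⟶ Y'),
      F.obj X ◁ F.map g ≫ φ X Y' = φ X Y ≫ M ◁ F.obj X ◁ F.map g) :
    ∃ h : EndPredual F ⊗ EndPredual F ⟶ M,
      ∀ X Y, tensorCoaction (coact F X) (coact F Y) ≫ h ▷ (F.obj X ⊗ F.obj Y) = φ X Y := by
  have h₁ (Y : C) := exists_lift F (N := F.obj Y) (M := M ⊗ F.obj Y)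
    (fun X => (β_ _ _).hom ≫ φ X Y ≫ M ◁ (β_ _ _).hom ≫ (α_ _ _ _).inv) (by
      intro X X' g
      rw [BraidedCategory.braiding_naturality_right_assoc, reassoc_of% (hl g Y),
        ← MonoidalCategory.whiskerLeft_comp_assoc, BraidedCategory.braiding_naturality_left]
      simp)
  choose ψ hψ using h₁
  -- The second lift needs naturality in `Y`; testing on the coactions in `X` reduces it to `hr`.
  have hψn ⦃Y Y' : C⦄ (g : Y ⟶ Y') : F.map g ▷ EndPredual F ≫ ψ Y' = ψ Y ≫ M ◁ F.map g := by
    refine separating_coact F _ _ fun X => ?_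
    rw [comp_whiskerRight, comp_whiskerRight, ← associator_inv_naturality_left_assoc,
      whisker_exchange_assoc, hψ, reassoc_of% (hψ Y X),
      BraidedCategory.braiding_naturality_left_assoc, reassoc_of% (hr X g),
      ← MonoidalCategory.whiskerLeft_comp_assoc, BraidedCategory.braiding_naturality_right]
    simp
  obtain ⟨h, hh⟩ := exists_lift F (N := EndPredual F) (M := M)
    (fun Y => (β_ _ _).hom ≫ ψ Y) (by
      intro Y Y' g
      rw [BraidedCategory.braiding_naturality_right_assoc, hψn, Category.assoc])
  refine ⟨h, fun X Y => ?_⟩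
  have e := tensorCoaction_swap (coact F X) (coact F Y)
  have e₂ := hψ Y X
  have e₁ := congrArg (fun k => F.obj Y ◁ coact F X ≫ (α_ _ _ _).inv ≫
    ((β_ (F.obj Y) (EndPredual F)).hom ≫ k) ▷ F.obj X) (hh Y)
  simp only [SymmetricCategory.symmetry_assoc, e₂] at e₁
  rw [← cancel_epi (β_ _ _).hom, ← cancel_mono (M ◁ (β_ _ _).hom),
    ← cancel_mono (α_ M (F.obj Y) (F.obj X)).inv]
  simp only [Category.assoc]
  rw [← e₁, ← whisker_exchange_assoc, associator_inv_naturality_left, ← reassoc_of% e]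
  simp

end TensorLift

/-! ### Naturality of the operations on coactions. -/

section CoactionLemmas

variable {V : Type u} [Category.{v} V] [MonoidalCategory V] {A A' B B' M M' N N' T T' : V}

lemma seqCoaction_comp_whiskerRight (d : A ⟶ M ⊗ A) (d' : A ⟶ M' ⊗ A) (f : M ⟶ T) (g : M' ⟶ T') :
    seqCoaction (d ≫ f ▷ A) (d' ≫ g ▷ A) = seqCoaction d d' ≫ (f ⊗ₘ g) ▷ A := by
  simp only [seqCoaction, MonoidalCategory.tensorHom_def, Category.assoc,
    MonoidalCategory.whiskerLeft_comp, comp_whiskerRight]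
  rw [← whisker_exchange_assoc]
  monoidal

lemma seqCoaction_comp_whiskerRight_left (d : A ⟶ M ⊗ A) (d' : A ⟶ M' ⊗ A) (f : M ⟶ T) :
    seqCoaction (d ≫ f ▷ A) d' = seqCoaction d d' ≫ f ▷ M' ▷ A := by
  simpa using seqCoaction_comp_whiskerRight d d' f (𝟙 M')

lemma seqCoaction_comp_whiskerRight_right (d : A ⟶ M ⊗ A) (d' : A ⟶ M' ⊗ A) (g : M' ⟶ T) :
    seqCoaction d (d' ≫ g ▷ A) = seqCoaction d d' ≫ (M ◁ g) ▷ A := by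
  simpa using seqCoaction_comp_whiskerRight d d' (𝟙 M) g

lemma seqCoaction_natural {d : A ⟶ M ⊗ A} {d' : A ⟶ M' ⊗ A} {e : B ⟶ M ⊗ B} {e' : B ⟶ M' ⊗ B}
    {f : A ⟶ B} (h : f ≫ e = d ≫ M ◁ f) (h' : f ≫ e' = d' ≫ M' ◁ f) :
    f ≫ seqCoaction e e' = seqCoaction d d' ≫ (M ⊗ M') ◁ f := by
  simp only [seqCoaction, reassoc_of% h, Category.assoc]
  rw [← MonoidalCategory.whiskerLeft_comp_assoc, h']
  simp

lemma coactRight_natural {d : A ⟶ M ⊗ A} {e : B ⟶ M ⊗ B} {f : A ⟶ B} (h : f ≫ e = d ≫ M ◁ f)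
    (X : V) : f ▷ X ≫ coactRight e X = coactRight d X ≫ M ◁ f ▷ X := by
  simp only [coactRight, ← comp_whiskerRight_assoc, h]
  simp

lemma coactRight_comp_whiskerRight (d : A ⟶ M ⊗ A) (f : M ⟶ N) (X : V) :
    coactRight (d ≫ f ▷ A) X = coactRight d X ≫ f ▷ (A ⊗ X) := by
  simp [coactRight]

lemma coactRight_naturality (d : A ⟶ M ⊗ A) {X Y : V} (f : X ⟶ Y) :
    A ◁ f ≫ coactRight d Y = coactRight d X ≫ M ◁ A ◁ f := by
  simp [coactRight, whisker_exchange_assoc]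

variable [BraidedCategory V]

lemma coactLeft_naturality {d : A ⟶ M ⊗ A} {e : B ⟶ M ⊗ B} {f : A ⟶ B} (h : f ≫ e = d ≫ M ◁ f)
    (X : V) : X ◁ f ≫ coactLeft X e = coactLeft X d ≫ M ◁ X ◁ f := by
  simp only [coactLeft, ← MonoidalCategory.whiskerLeft_comp_assoc, h, Category.assoc]
  rw [MonoidalCategory.whiskerLeft_comp_assoc, associator_inv_naturality_right_assoc,
    whisker_exchange_assoc]
  simp

lemma coactLeft_comp_whiskerRight (X : V) (d : A ⟶ M ⊗ A) (f : M ⟶ N) :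
    coactLeft X (d ≫ f ▷ A) = coactLeft X d ≫ f ▷ (X ⊗ A) := by
  simp only [coactLeft, MonoidalCategory.whiskerLeft_comp, Category.assoc,
    associator_inv_naturality_middle_assoc, ← comp_whiskerRight_assoc,
    BraidedCategory.braiding_naturality_right]
  simp

lemma coactLeft_rightUnitor_inv (X : V) (u : 𝟙_ V ⟶ M) :
    coactLeft X (u ≫ (ρ_ M).inv) = (ρ_ X).hom ≫ (λ_ X).inv ≫ u ▷ X ≫ M ◁ (ρ_ X).inv := by
  have h := BraidedCategory.braiding_naturality_right X u
  rw [braiding_tensorUnit_right] at h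
  calc
    _ = 𝟙 _ ⊗≫ (X ◁ u ≫ (β_ X M).hom) ⊗≫ 𝟙 _ := by
      simp only [coactLeft]; monoidal
    _ = _ := by rw [h]; monoidal

lemma tensorCoaction_comp_whiskerRight_left (d : A ⟶ M ⊗ A) (e : B ⟶ N ⊗ B) (f : M ⟶ T) :
    tensorCoaction (d ≫ f ▷ A) e = tensorCoaction d e ≫ f ▷ N ▷ (A ⊗ B) := by
  simpa using tensorCoaction_comp_whiskerRight d e f (𝟙 N)

lemma tensorCoaction_comp_whiskerRight_right (d : A ⟶ M ⊗ A) (e : B ⟶ N ⊗ B) (g : N ⟶ T) :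
    tensorCoaction d (e ≫ g ▷ B) = tensorCoaction d e ≫ (M ◁ g) ▷ (A ⊗ B) := by
  simpa using tensorCoaction_comp_whiskerRight d e (𝟙 M) g

lemma tensorCoaction_natural {d : A ⟶ M ⊗ A} {d' : A' ⟶ M ⊗ A'} {e : B ⟶ N ⊗ B}
    {e' : B' ⟶ N ⊗ B'} {f : A ⟶ A'} {g : B ⟶ B'} (hf : f ≫ d' = d ≫ M ◁ f)
    (hg : g ≫ e' = e ≫ N ◁ g) :
    (f ⊗ₘ g) ≫ tensorCoaction d' e' = tensorCoaction d e ≫ (M ⊗ N) ◁ (f ⊗ₘ g) := by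
  have h := tensorμ_natural (𝟙 M) f (𝟙 N) g
  rw [id_tensorHom, id_tensorHom, id_tensorHom_id, id_tensorHom] at h
  simp only [tensorCoaction, tensorHom_comp_tensorHom_assoc, hf, hg, Category.assoc, ← h]

lemma tensorCoaction_natural_left {d : A ⟶ M ⊗ A} {d' : A' ⟶ M ⊗ A'} {f : A ⟶ A'}
    (hf : f ≫ d' = d ≫ M ◁ f) (e : B ⟶ N ⊗ B) :
    f ▷ B ≫ tensorCoaction d' e = tensorCoaction d e ≫ (M ⊗ N) ◁ f ▷ B := by
  simpa using tensorCoaction_natural (g := 𝟙 B) (e := e) hf (by simp)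

lemma tensorCoaction_natural_right (d : A ⟶ M ⊗ A) {e : B ⟶ N ⊗ B} {e' : B' ⟶ N ⊗ B'}
    {g : B ⟶ B'} (hg : g ≫ e' = e ≫ N ◁ g) :
    A ◁ g ≫ tensorCoaction d e' = tensorCoaction d e ≫ (M ⊗ N) ◁ A ◁ g := by
  simpa using tensorCoaction_natural (f := 𝟙 A) (d := d) (by simp) hg

lemma tensorCoaction_leftUnitor_inv (e : B ⟶ N ⊗ B) (A : V) :
    tensorCoaction (λ_ A).inv e = coactLeft A e ≫ (λ_ N).inv ▷ (A ⊗ B) := by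
  rw [tensorCoaction_eq_seqCoaction]
  simp only [seqCoaction, coactRight]
  monoidal

lemma tensorCoaction_rightUnitor_inv (d : A ⟶ M ⊗ A) (B : V) :
    tensorCoaction d (λ_ B).inv = coactRight d B ≫ (ρ_ M).inv ▷ (A ⊗ B) := by
  rw [tensorCoaction_eq_seqCoaction]
  simp only [seqCoaction, coactRight, coactLeft, braiding_tensorUnit_right]
  monoidal

end CoactionLemmas

/-! ### Coactions transported to a dual object. -/

section DualCoaction

variable {V : Type u} [Category.{v} V] [MonoidalCategory V] [BraidedCategory V]

/-- The coaction on `A` obtained from a coaction on a right dual `D` of `A`. -/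
def dualCoaction {D A M : V} [ExactPairing D A] (d : D ⟶ M ⊗ D) : A ⟶ M ⊗ A :=
  (ρ_ A).inv ≫ A ◁ η_ D A ≫ coactLeft A (coactRight d A) ≫
    M ◁ ((α_ A D A).inv ≫ ε_ D A ▷ A ≫ (λ_ A).hom)

lemma dualCoaction_natural {D A D' A' M : V} [ExactPairing D A] [ExactPairing D' A']
    {d : D ⟶ M ⊗ D} {d' : D' ⟶ M ⊗ D'} {f : A ⟶ A'} {g : D' ⟶ D} (h : g ≫ d = d' ≫ M ◁ g)
    (hη : η_ D' A' ≫ g ▷ A' = η_ D A ≫ D ◁ f) (hε : A ◁ g ≫ ε_ D A = f ▷ D' ≫ ε_ D' A') :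
    f ≫ dualCoaction d' = dualCoaction d ≫ M ◁ f := by
  simp only [dualCoaction]
  have h₁ : f ▷ (D' ⊗ A') ≫ (α_ A' D' A').inv ≫ ε_ D' A' ▷ A' ≫ (λ_ A').hom =
      A ◁ g ▷ A' ≫ (α_ A D A').inv ≫ ε_ D A ▷ A' ≫ (λ_ A').hom := by
    rw [associator_inv_naturality_left_assoc, ← comp_whiskerRight_assoc, ← hε]
    simp
  rw [rightUnitor_inv_naturality_assoc, ← whisker_exchange_assoc, reassoc_of% coactLeft_natural,
    ← MonoidalCategory.whiskerLeft_comp, h₁, MonoidalCategory.whiskerLeft_comp,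
    ← reassoc_of% coactLeft_naturality (coactRight_natural h A') A,
    ← MonoidalCategory.whiskerLeft_comp_assoc, hη, MonoidalCategory.whiskerLeft_comp_assoc,
    reassoc_of% coactLeft_naturality (coactRight_naturality d f) A]
  simp only [Category.assoc, ← MonoidalCategory.whiskerLeft_comp]
  rw [associator_inv_naturality_right_assoc, whisker_exchange_assoc, leftUnitor_naturality]

/-- The coaction `e` slides back past the final evaluation, so `D ⊗ A` carries a tensor coaction
right after the coevaluation. -/
lemma seqCoaction_dualCoaction_left {D A M N : V} [ExactPairing D A] (d : D ⟶ M ⊗ D)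
    (e : A ⟶ N ⊗ A) :
    seqCoaction (dualCoaction d) e = (ρ_ A).inv ≫ A ◁ η_ D A ≫ coactLeft A (tensorCoaction d e) ≫
      (M ⊗ N) ◁ ((α_ A D A).inv ≫ ε_ D A ▷ A ≫ (λ_ A).hom) := by
  have h : ((α_ A D A).inv ≫ ε_ D A ▷ A ≫ (λ_ A).hom) ≫ e =
      coactLeft A (coactLeft D e) ≫ N ◁ ((α_ A D A).inv ≫ ε_ D A ▷ A ≫ (λ_ A).hom) := by
    rw [coactLeft_coactLeft]
    simp only [Category.assoc, ← MonoidalCategory.whiskerLeft_comp, Iso.hom_inv_id_assoc]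
    simp only [MonoidalCategory.whiskerLeft_comp, ← reassoc_of% coactLeft_natural, coactLeft_unit,
      Category.assoc, whiskerLeft_inv_hom, Category.comp_id]
  rw [tensorCoaction_eq_seqCoaction, coactLeft_seqCoaction]
  simp only [seqCoaction, dualCoaction, Category.assoc]
  rw [← MonoidalCategory.whiskerLeft_comp_assoc, h]
  simp only [MonoidalCategory.whiskerLeft_comp, Category.assoc]
  monoidal

/-- In this order `e` slides past the coevaluation instead, and the tensor coaction on `A ⊗ D` sits
right before the evaluation. -/
lemma seqCoaction_dualCoaction_right {D A M N : V} [ExactPairing D A] (d : D ⟶ M ⊗ D)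
    (e : A ⟶ N ⊗ A) :
    seqCoaction e (dualCoaction d) = (ρ_ A).inv ≫ A ◁ η_ D A ≫ (α_ A D A).inv ≫
      coactRight (tensorCoaction e d) A ≫ (N ⊗ M) ◁ (ε_ D A ▷ A ≫ (λ_ A).hom) := by
  rw [tensorCoaction_eq_seqCoaction]
  simp only [seqCoaction, dualCoaction, coactLeft, coactRight]
  calc
    _ = 𝟙 _ ⊗≫ (e ▷ 𝟙_ V ≫ (N ⊗ A) ◁ η_ D A) ⊗≫ N ◁ (A ◁ d ▷ A ⊗≫ (β_ A M).hom ▷ D ▷ A) ⊗≫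
        (N ⊗ M) ◁ ε_ D A ▷ A ⊗≫ 𝟙 _ := by monoidal
    _ = _ := by rw [← whisker_exchange]; monoidal

end DualCoaction

/-! ### The coalgebra structure. -/

section Coalgebra

variable {C : Type w} [Category.{w'} C] {V : Type u} [Category.{v} V] [MonoidalCategory V]
  (F : C ⥤ V) [∀ X : C, HasLeftDual (F.obj X)] [HasCoend (bifunctor F)]

lemma incl_eq (X : C) :
    incl F X = (tensorRightHomEquiv _ _ _ _).symm (coact F X) := by
  rw [coact, Equiv.symm_apply_apply]

lemma incl_comp {X : C} {M : V} (h : EndPredual F ⟶ M) :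
    incl F X ≫ h = (tensorRightHomEquiv _ _ _ _).symm (coact F X ≫ h ▷ F.obj X) := by
  rw [Equiv.eq_symm_apply, tensorRightHomEquiv_naturality, coact]

variable [MonoidalClosed V]

/-- The comultiplication of `End^∨(F)`. -/
noncomputable def comulMap : EndPredual F ⟶ EndPredual F ⊗ EndPredual F :=
  (exists_lift_of_natural F (fun X => seqCoaction (coact F X) (coact F X))
    fun _ _ g => seqCoaction_natural (coact_natural F g) (coact_natural F g)).choose

lemma coact_comulMap (X : C) :
    coact F X ≫ comulMap F ▷ F.obj X = seqCoaction (coact F X) (coact F X) :=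
  (exists_lift_of_natural F (fun X => seqCoaction (coact F X) (coact F X))
    fun _ _ g => seqCoaction_natural (coact_natural F g) (coact_natural F g)).choose_spec X

/-- The counit of `End^∨(F)`. -/
noncomputable def counitMap : EndPredual F ⟶ 𝟙_ V :=
  (exists_lift_of_natural F (fun X => (λ_ (F.obj X)).inv)
    fun _ _ g => leftUnitor_inv_naturality (F.map g)).choose

lemma coact_counitMap (X : C) : coact F X ≫ counitMap F ▷ F.obj X = (λ_ (F.obj X)).inv :=
  (exists_lift_of_natural F (fun X => (λ_ (F.obj X)).inv)
    fun _ _ g => leftUnitor_inv_naturality (F.map g)).choose_spec X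

lemma incl_comulMap (X : C) : incl F X ≫ comulMap F = comulComponent F X := by
  rw [incl_comp, coact_comulMap]
  have h := incl_eq F X
  simp only [tensorRightHomEquiv, Equiv.coe_fn_symm_mk] at h
  rw [comulComponent, MonoidalCategory.tensorHom_def]
  nth_rw 2 [h]
  simp only [tensorRightHomEquiv, Equiv.coe_fn_symm_mk, seqCoaction]
  nth_rw 1 [coact]
  simp only [tensorRightHomEquiv, Equiv.coe_fn_mk]
  monoidal

lemma incl_counitMap (X : C) : incl F X ≫ counitMap F = counitComponent F X := by
  rw [incl_comp, coact_counitMap, counitComponent]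
  simp only [tensorRightHomEquiv, Equiv.coe_fn_symm_mk]
  monoidal

lemma comulMap_counitMap_left : comulMap F ≫ counitMap F ▷ EndPredual F = (λ_ _).inv := by
  refine (separating_coact F).hom_ext fun X => ?_
  rw [comp_whiskerRight, reassoc_of% coact_comulMap, ← seqCoaction_comp_whiskerRight_left,
    coact_counitMap]
  simp only [seqCoaction]
  monoidal

lemma comulMap_counitMap_right : comulMap F ≫ EndPredual F ◁ counitMap F = (ρ_ _).inv := by
  refine (separating_coact F).hom_ext fun X => ?_
  rw [comp_whiskerRight, reassoc_of% coact_comulMap, ← seqCoaction_comp_whiskerRight_right,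
    coact_counitMap]
  simp only [seqCoaction]
  monoidal

lemma comulMap_assoc :
    comulMap F ≫ EndPredual F ◁ comulMap F =
      comulMap F ≫ comulMap F ▷ EndPredual F ≫ (α_ _ _ _).hom := by
  refine (separating_coact F).hom_ext fun X => ?_
  rw [comp_whiskerRight, reassoc_of% coact_comulMap, ← seqCoaction_comp_whiskerRight_right,
    coact_comulMap, comp_whiskerRight, reassoc_of% coact_comulMap, comp_whiskerRight,
    ← reassoc_of% seqCoaction_comp_whiskerRight_left, coact_comulMap]
  simp only [seqCoaction]
  monoidal

end Coalgebra

/-! ### Transposing a pair of components of λ. -/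

section TensorIncl

variable {C : Type w} [Category.{w'} C] {V : Type u} [Category.{v} V] [MonoidalCategory V]
  [BraidedCategory V] (F : C ⥤ V) [∀ X : C, HasLeftDual (F.obj X)] [HasCoend (bifunctor F)]

lemma incl_tensor_comp {X Y : C} {M : V} (h : EndPredual F ⊗ EndPredual F ⟶ M) :
    (incl F X ⊗ₘ incl F Y) ≫ h =
      tensorμ _ _ _ _ ≫ (F.obj X ⊗ F.obj Y) ◁ (β_ _ _).hom ≫
        (tensorRightHomEquiv _ ((ᘁ(F.obj Y) : V) ⊗ (ᘁ(F.obj X) : V)) (F.obj X ⊗ F.obj Y) _).symm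
          (tensorCoaction (coact F X) (coact F Y) ≫ h ▷ (F.obj X ⊗ F.obj Y)) := by
  rw [incl_eq, incl_eq, ← tensorRightHomEquiv_symm_tensorCoaction]
  simp only [Category.assoc]
  congr 2
  rw [Equiv.eq_symm_apply, tensorRightHomEquiv_naturality, Equiv.apply_symm_apply]

end TensorIncl

/-! ### The unit, and its compatibility with the coalgebra structure. -/

section UnitMap

open Functor.LaxMonoidal Functor.OplaxMonoidal

variable {C : Type w} [Category.{w'} C] [MonoidalCategory C] {V : Type u} [Category.{v} V]
  [MonoidalCategory V] (F : C ⥤ V) [F.Monoidal]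
  [∀ X : C, HasLeftDual (F.obj X)] [HasCoend (bifunctor F)]

/-- Transposition replaces the mate of `η F` in the definition by `η F` applied after the coaction,
so u is the coaction on `F.obj (𝟙_ C)` carried to `𝟙_ V`. -/
lemma unitMap_eq : unitMap F =
    ε F ≫ coact F (𝟙_ C) ≫ EndPredual F ◁ η F ≫ (ρ_ (EndPredual F)).hom := by
  have h := @tensorRightHomEquiv_whiskerLeft_leftAdjointMate V _ _ (F.obj (𝟙_ C)) (𝟙_ V) _
    hasLeftDualUnit (η F) _ _ (incl F (𝟙_ C))
  rw [← coact] at h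
  rw [← reassoc_of% h, unitMap, MonoidalCategory.tensorHom_def, dualUnitComparison]
  simp only [tensorRightHomEquiv, Equiv.coe_fn_mk]
  -- The pairing is that of `hasLeftDualUnit`, in which the unit object is its own dual.
  have h' : η_ (𝟙_ V) (𝟙_ V) = (ρ_ (𝟙_ V)).inv := rfl
  change _ = ε F ≫ ((ρ_ (F.obj (𝟙_ C))).inv ≫ F.obj (𝟙_ C) ◁ η_ (𝟙_ V) (𝟙_ V) ≫
    (α_ (F.obj (𝟙_ C)) (𝟙_ V) (𝟙_ V)).inv ≫ _) ≫ _
  rw [h']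
  monoidal

/-- The coaction of `End^∨(F)` on the unit object. -/
noncomputable def unitCoact : 𝟙_ V ⟶ EndPredual F ⊗ 𝟙_ V := unitMap F ≫ (ρ_ _).inv

lemma ε_coact : ε F ≫ coact F (𝟙_ C) = unitCoact F ≫ EndPredual F ◁ ε F := by
  simp [unitCoact, unitMap_eq, ← MonoidalCategory.whiskerLeft_comp]

lemma η_unitCoact : η F ≫ unitCoact F = coact F (𝟙_ C) ≫ EndPredual F ◁ η F := by
  simp [unitCoact, unitMap_eq]

variable [MonoidalClosed V]

lemma unitMap_comulMap : unitMap F ≫ comulMap F =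
    (λ_ (𝟙_ V)).inv ≫ (unitMap F ⊗ₘ unitMap F) := by
  have h : unitCoact F ≫ comulMap F ▷ 𝟙_ V = seqCoaction (unitCoact F) (unitCoact F) := by
    rw [← cancel_mono (_ ◁ ε F), Category.assoc, ← whisker_exchange, ← reassoc_of% ε_coact F,
      coact_comulMap]
    exact seqCoaction_natural (ε_coact F) (ε_coact F)
  rw [← cancel_mono (ρ_ _).inv]
  simp only [unitCoact, seqCoaction] at h
  calc
    _ = (unitMap F ≫ (ρ_ _).inv) ≫ comulMap F ▷ 𝟙_ V := by simp
    _ = _ := by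
      rw [h, MonoidalCategory.tensorHom_def]
      monoidal

lemma unitMap_counitMap : unitMap F ≫ counitMap F = 𝟙 _ := by
  have h : unitCoact F ≫ counitMap F ▷ 𝟙_ V = (λ_ _).inv := by
    rw [← cancel_mono (_ ◁ ε F), Category.assoc, ← whisker_exchange, ← reassoc_of% ε_coact F,
      coact_counitMap, leftUnitor_inv_naturality]
  rw [unitCoact, Category.assoc, ← rightUnitor_inv_naturality] at h
  rw [← cancel_mono (ρ_ _).inv, Category.assoc, h]
  monoidal

lemma coact_counitMap_unitMap (X : C) :
    coact F X ≫ (counitMap F ≫ unitMap F) ▷ F.obj X =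
      (λ_ (F.obj X)).inv ≫ unitMap F ▷ F.obj X := by
  rw [comp_whiskerRight, reassoc_of% coact_counitMap]

end UnitMap

/-! ### The multiplication and the bialgebra axioms. -/

section Bialgebra

open Functor.LaxMonoidal Functor.OplaxMonoidal

variable {C : Type w} [Category.{w'} C] [MonoidalCategory C] {V : Type u} [Category.{v} V]
  [MonoidalCategory V] [SymmetricCategory V] [MonoidalClosed V] (F : C ⥤ V) [F.Monoidal]
  [∀ X : C, HasLeftDual (F.obj X)] [HasCoend (bifunctor F)]

lemma exists_mulMap : ∃ m : EndPredual F ⊗ EndPredual F ⟶ EndPredual F, ∀ X Y,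
    tensorCoaction (coact F X) (coact F Y) ≫ m ▷ (F.obj X ⊗ F.obj Y) =
      μ F X Y ≫ coact F (X ⊗ Y) ≫ EndPredual F ◁ δ F X Y := by
  refine exists_tensor_lift F _ (fun X X' g Y => ?_) (fun X Y Y' g => ?_)
  · rw [μ_natural_left_assoc, reassoc_of% coact_natural, Category.assoc, Category.assoc,
      ← MonoidalCategory.whiskerLeft_comp, ← MonoidalCategory.whiskerLeft_comp, δ_natural_left]
  · rw [μ_natural_right_assoc, reassoc_of% coact_natural, Category.assoc, Category.assoc,
      ← MonoidalCategory.whiskerLeft_comp, ← MonoidalCategory.whiskerLeft_comp, δ_natural_right]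

/-- The multiplication of `End^∨(F)`. -/
noncomputable def mulMap : EndPredual F ⊗ EndPredual F ⟶ EndPredual F :=
  (exists_mulMap F).choose

/-- The coaction of `End^∨(F)` on `F C ⊗ F D`. -/
noncomputable def tensorCoact (X Y : C) : F.obj X ⊗ F.obj Y ⟶ EndPredual F ⊗ F.obj X ⊗ F.obj Y :=
  tensorCoaction (coact F X) (coact F Y) ≫ mulMap F ▷ (F.obj X ⊗ F.obj Y)

lemma tensorCoaction_mulMap (X Y : C) :
    tensorCoaction (coact F X) (coact F Y) ≫ mulMap F ▷ (F.obj X ⊗ F.obj Y) =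
      tensorCoact F X Y := rfl

lemma tensorCoact_eq (X Y : C) :
    tensorCoact F X Y = μ F X Y ≫ coact F (X ⊗ Y) ≫ EndPredual F ◁ δ F X Y :=
  (exists_mulMap F).choose_spec X Y

lemma μ_coact (X Y : C) :
    μ F X Y ≫ coact F (X ⊗ Y) = tensorCoact F X Y ≫ EndPredual F ◁ μ F X Y := by
  rw [tensorCoact_eq]
  simp [← MonoidalCategory.whiskerLeft_comp]

lemma δ_tensorCoact (X Y : C) :
    δ F X Y ≫ tensorCoact F X Y = coact F (X ⊗ Y) ≫ EndPredual F ◁ δ F X Y := by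
  rw [tensorCoact_eq]
  simp

lemma incl_mulMap (X Y : C) :
    (incl F X ⊗ₘ incl F Y) ≫ mulMap F = mulComponent F X Y := by
  rw [incl_tensor_comp, mulComponent, MonoidalCategory.tensorHom_def, Category.assoc]
  congr 2
  rw [Equiv.symm_apply_eq, ← tensorCoact, tensorCoact_eq, coact]
  -- The instance `hasLeftDualTensor` makes the product of the duals, in reverse order, the dual of
  -- `F.obj X ⊗ F.obj Y`.
  have h := @tensorRightHomEquiv_whiskerLeft_leftAdjointMate V _ _ (F.obj (X ⊗ Y))
    (F.obj X ⊗ F.obj Y) _ hasLeftDualTensor (δ F X Y) _ _ (incl F (X ⊗ Y))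
  rw [← h, ← (tensorRightHomEquiv _ ((ᘁ(F.obj Y) : V) ⊗ (ᘁ(F.obj X) : V))
    (F.obj X ⊗ F.obj Y) _).symm.injective.eq_iff, Equiv.symm_apply_apply]
  erw [tensorRightHomEquiv_symm_naturality, Equiv.symm_apply_apply]
  rfl

/-- Tested on triple tensor coactions, the two sides are the coactions on F of the two bracketings,
moved along composites of `μ`. -/
lemma mulMap_assoc :
    mulMap F ▷ EndPredual F ≫ mulMap F =
      (α_ _ _ _).hom ≫ EndPredual F ◁ mulMap F ≫ mulMap F := by
  refine (((separating_coact F).tensor (separating_coact F)).tensor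
    (separating_coact F)).hom_ext fun ⟨⟨X, Y⟩, Z⟩ => ?_
  dsimp only
  have h₁ : tensorCoaction (tensorCoaction (coact F X) (coact F Y)) (coact F Z) ≫
      (mulMap F ▷ EndPredual F ≫ mulMap F) ▷ ((F.obj X ⊗ F.obj Y) ⊗ F.obj Z) =
      tensorCoaction (tensorCoact F X Y) (coact F Z) ≫ mulMap F ▷ _ := by
    rw [comp_whiskerRight, ← reassoc_of% tensorCoaction_comp_whiskerRight_left, tensorCoact]
  have h₂ : tensorCoaction (coact F X) (tensorCoaction (coact F Y) (coact F Z)) ≫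
      (EndPredual F ◁ mulMap F ≫ mulMap F) ▷ (F.obj X ⊗ F.obj Y ⊗ F.obj Z) =
      tensorCoaction (coact F X) (tensorCoact F Y Z) ≫ mulMap F ▷ _ := by
    rw [comp_whiskerRight, ← reassoc_of% tensorCoaction_comp_whiskerRight_right, tensorCoact]
  have h₃ : (μ F X Y ▷ F.obj Z ≫ μ F (X ⊗ Y) Z) ≫ coact F ((X ⊗ Y) ⊗ Z) =
      (tensorCoaction (tensorCoact F X Y) (coact F Z) ≫ mulMap F ▷ _) ≫
        EndPredual F ◁ (μ F X Y ▷ F.obj Z ≫ μ F (X ⊗ Y) Z) := by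
    rw [Category.assoc, μ_coact, tensorCoact]
    simp only [Category.assoc, reassoc_of% tensorCoaction_natural_left (μ_coact F X Y),
      whisker_exchange_assoc, MonoidalCategory.whiskerLeft_comp]
  have h₄ : (F.obj X ◁ μ F Y Z ≫ μ F X (Y ⊗ Z)) ≫ coact F (X ⊗ Y ⊗ Z) =
      (tensorCoaction (coact F X) (tensorCoact F Y Z) ≫ mulMap F ▷ _) ≫
        EndPredual F ◁ (F.obj X ◁ μ F Y Z ≫ μ F X (Y ⊗ Z)) := by
    rw [Category.assoc, μ_coact, tensorCoact]
    simp only [Category.assoc, reassoc_of% tensorCoaction_natural_right _ (μ_coact F Y Z),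
      whisker_exchange_assoc, MonoidalCategory.whiskerLeft_comp]
  rw [h₁, comp_whiskerRight, reassoc_of% tensorCoaction_assoc,
    whisker_exchange, reassoc_of% h₂,
    ← cancel_mono (EndPredual F ◁ (μ F X Y ▷ F.obj Z ≫ μ F (X ⊗ Y) Z)), ← h₃]
  -- The coaction is natural for the associator of C, which links the two bracketings.
  rw [← cancel_mono (EndPredual F ◁ F.map (α_ X Y Z).hom)]
  simp only [Category.assoc]
  rw [← coact_natural]
  have h₅ := Functor.LaxMonoidal.associativity F X Y Z
  simp only [← MonoidalCategory.whiskerLeft_comp, Category.assoc, h₅, Iso.inv_hom_id_assoc,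
    reassoc_of% h₅]
  simp only [Category.assoc] at h₄
  rw [h₄]

lemma mulMap_one_left : unitMap F ▷ EndPredual F ≫ mulMap F = (λ_ _).hom := by
  rw [← cancel_epi (λ_ _).inv, Iso.inv_hom_id]
  refine (separating_coact F).hom_ext fun X => ?_
  rw [id_whiskerRight, Category.comp_id]
  have h₁ : unitCoact F = (λ_ _).inv ≫ unitMap F ▷ 𝟙_ V := by
    rw [unitCoact]; monoidal
  have h₂ : (λ_ (F.obj X)).hom ≫ coact F X = tensorCoaction (unitCoact F) (coact F X) ≫
      mulMap F ▷ _ ≫ EndPredual F ◁ (λ_ (F.obj X)).hom := by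
    rw [Functor.LaxMonoidal.left_unitality F X, Category.assoc, Category.assoc, coact_natural,
      reassoc_of% μ_coact F (𝟙_ C) X, tensorCoact]
    simp only [Category.assoc, reassoc_of% tensorCoaction_natural_left (ε_coact F),
      whisker_exchange_assoc, MonoidalCategory.whiskerLeft_comp]
  rw [h₁, tensorCoaction_comp_whiskerRight_left, tensorCoaction_leftUnitor_inv,
    coactLeft_unit] at h₂
  rw [← cancel_epi (λ_ (F.obj X)).hom, h₂]
  simp only [comp_whiskerRight, Category.assoc, ← whisker_exchange, ← whisker_exchange_assoc]
  monoidal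

lemma mulMap_one_right : EndPredual F ◁ unitMap F ≫ mulMap F = (ρ_ _).hom := by
  rw [← cancel_epi (ρ_ _).inv, Iso.inv_hom_id]
  refine (separating_coact F).hom_ext fun X => ?_
  rw [id_whiskerRight, Category.comp_id]
  have h₁ : unitCoact F = (λ_ _).inv ≫ unitMap F ▷ 𝟙_ V := by
    rw [unitCoact]; monoidal
  have h₂ : (ρ_ (F.obj X)).hom ≫ coact F X = tensorCoaction (coact F X) (unitCoact F) ≫
      mulMap F ▷ _ ≫ EndPredual F ◁ (ρ_ (F.obj X)).hom := by
    rw [Functor.LaxMonoidal.right_unitality F X, Category.assoc, Category.assoc, coact_natural,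
      reassoc_of% μ_coact F X (𝟙_ C), tensorCoact]
    simp only [Category.assoc, reassoc_of% tensorCoaction_natural_right _ (ε_coact F),
      whisker_exchange_assoc, MonoidalCategory.whiskerLeft_comp]
  rw [h₁, tensorCoaction_comp_whiskerRight_right, tensorCoaction_rightUnitor_inv] at h₂
  rw [← cancel_epi (ρ_ (F.obj X)).hom, h₂]
  simp only [coactRight, comp_whiskerRight, Category.assoc, ← whisker_exchange,
    ← whisker_exchange_assoc]
  monoidal

/-- Both sides amount to coacting twice on `F.obj X ⊗ F.obj Y`; for the left side this is seen after
moving along `μ` to `F.obj (X ⊗ Y)`. -/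
lemma mulMap_comulMap : mulMap F ≫ comulMap F =
    (comulMap F ⊗ₘ comulMap F) ≫ tensorμ _ _ _ _ ≫ (mulMap F ⊗ₘ mulMap F) := by
  refine ((separating_coact F).tensor (separating_coact F)).hom_ext fun ⟨X, Y⟩ => ?_
  dsimp only
  rw [comp_whiskerRight, comp_whiskerRight, comp_whiskerRight,
    ← reassoc_of% tensorCoaction_comp_whiskerRight, coact_comulMap, coact_comulMap,
    reassoc_of% tensorCoaction_seqCoaction, ← seqCoaction_comp_whiskerRight,
    tensorCoaction_mulMap, reassoc_of% tensorCoaction_mulMap, ← cancel_mono (_ ◁ μ F X Y),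
    Category.assoc, ← whisker_exchange,
    ← reassoc_of% μ_coact F X Y, coact_comulMap]
  exact seqCoaction_natural (μ_coact F X Y) (μ_coact F X Y)

lemma mulMap_counitMap : mulMap F ≫ counitMap F =
    (counitMap F ⊗ₘ counitMap F) ≫ (λ_ (𝟙_ V)).hom := by
  refine ((separating_coact F).tensor (separating_coact F)).hom_ext fun ⟨X, Y⟩ => ?_
  dsimp only
  rw [comp_whiskerRight, comp_whiskerRight,
    ← reassoc_of% tensorCoaction_comp_whiskerRight, coact_counitMap, coact_counitMap,
    tensorCoaction_leftUnitor_inv, reassoc_of% tensorCoaction_mulMap, tensorCoact_eq]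
  simp only [Category.assoc, whisker_exchange, reassoc_of% coact_counitMap F (X ⊗ Y)]
  simp only [coactLeft, braiding_tensorUnit_right, ← leftUnitor_inv_naturality,
    Functor.Monoidal.μ_δ_assoc]
  monoidal

end Bialgebra

/-! ### Independence of the chosen dual, and dualities preserved by F. -/

section LeftDualIso

variable {V : Type u} [Category.{v} V] [MonoidalCategory V]

/-- `leftDualIso` is the mate of an identity, so this is a case of the mate formula. -/
lemma tensorRightHomEquiv_whiskerLeft_leftDualIso {A D D' X M : V} (p : ExactPairing D A)
    (p' : ExactPairing D' A) (q : X ⊗ D' ⟶ M) :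
    @tensorRightHomEquiv V _ _ X D A M p (X ◁ (leftDualIso p p').hom ≫ q) =
      @tensorRightHomEquiv V _ _ X D' A M p' q := by
  have h := @tensorRightHomEquiv_whiskerLeft_leftAdjointMate V _ _ A A ⟨D'⟩ ⟨D⟩ (𝟙 A) X M q
  rw [MonoidalCategory.whiskerLeft_id, Category.comp_id] at h
  exact h

end LeftDualIso

section MapPairing

open Functor.LaxMonoidal Functor.OplaxMonoidal

variable {C : Type w} [Category.{w'} C] [MonoidalCategory C] {V : Type u} [Category.{v} V]
  [MonoidalCategory V] (F : C ⥤ V) [F.Monoidal]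

lemma mapPairing_coevaluation (X Y : C) [ExactPairing X Y] :
    (mapPairing F X Y).coevaluation' = ε F ≫ F.map (η_ X Y) ≫ δ F X Y := rfl

lemma mapPairing_evaluation (X Y : C) [ExactPairing X Y] :
    (mapPairing F X Y).evaluation' = μ F Y X ≫ F.map (ε_ X Y) ≫ η F := rfl

variable [LeftRigidCategory C]

lemma mapPairing_coevaluation_natural {X Y : C} (g : X ⟶ Y) :
    (mapPairing F (ᘁY : C) Y).coevaluation' ≫ F.map (ᘁg) ▷ F.obj Y =
      (mapPairing F (ᘁX : C) X).coevaluation' ≫ F.obj (ᘁX : C) ◁ F.map g := by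
  simp only [mapPairing_coevaluation, Category.assoc, δ_natural_left, δ_natural_right,
    ← F.map_comp_assoc,
    coevaluation_comp_leftAdjointMate]

lemma mapPairing_evaluation_natural {X Y : C} (g : X ⟶ Y) :
    F.obj X ◁ F.map (ᘁg) ≫ (mapPairing F (ᘁX : C) X).evaluation' =
      F.map g ▷ F.obj (ᘁY : C) ≫ (mapPairing F (ᘁY : C) Y).evaluation' := by
  simp only [mapPairing_evaluation, μ_natural_left_assoc, μ_natural_right_assoc, ← F.map_comp_assoc,
    leftAdjointMate_comp_evaluation]

end MapPairing

/-! ### The antipode and the Hopf algebra. -/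

section Antipode

open Functor.LaxMonoidal Functor.OplaxMonoidal

variable {C : Type w} [Category.{w'} C] [MonoidalCategory C] [LeftRigidCategory C]
  {V : Type u} [Category.{v} V] [MonoidalCategory V] [SymmetricCategory V]
  (F : C ⥤ V) [F.Monoidal]
  [∀ X : C, HasLeftDual (F.obj X)] [HasCoend (bifunctor F)]

/-- The coaction on `F C` obtained from the universal coaction on `F (C^∧)` by duality. -/
noncomputable def antipodeCoact (X : C) : F.obj X ⟶ EndPredual F ⊗ F.obj X :=
  letI := mapPairing F (ᘁX : C) X
  dualCoaction (coact F (ᘁX : C))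

lemma antipodeCoact_natural {X Y : C} (g : X ⟶ Y) :
    F.map g ≫ antipodeCoact F Y = antipodeCoact F X ≫ EndPredual F ◁ F.map g :=
  letI := mapPairing F (ᘁX : C) X
  letI := mapPairing F (ᘁY : C) Y
  dualCoaction_natural (coact_natural F (ᘁg)) (mapPairing_coevaluation_natural F g)
    (mapPairing_evaluation_natural F g)

lemma whiskerLeft_doubleDualIso_incl (X : C) :
    letI := mapPairing F (ᘁX : C) X
    F.obj (ᘁX : C) ◁ (doubleDualIso F X).hom ≫ incl F (ᘁX : C) =
      coactRight (coact F (ᘁX : C)) (F.obj X) ≫ EndPredual F ◁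
        ((β_ (F.obj (ᘁX : C)) (F.obj X)).hom ≫ ε_ (F.obj (ᘁX : C)) (F.obj X)) ≫ (ρ_ _).hom := by
  let := mapPairing F (ᘁX : C) X
  have h := tensorRightHomEquiv_whiskerLeft_leftDualIso
    (BraidedCategory.exactPairing_swap (F.obj (ᘁX : C)) (F.obj X)) HasLeftDual.exact
    (incl F (ᘁX : C))
  rw [← Equiv.eq_symm_apply] at h
  refine h.trans ?_
  simp only [tensorRightHomEquiv, Equiv.coe_fn_symm_mk, coactRight, Category.assoc]
  rfl

lemma tensorRightHomEquiv_antipodeComponent (X : C) :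
    tensorRightHomEquiv _ _ _ _ (antipodeComponent F X) = antipodeCoact F X := by
  let := mapPairing F (ᘁX : C) X
  -- The symmetry ψ and the one in the swapped evaluation combine, leaving only the crossing of
  -- `F.obj X` with E that occurs in `dualCoaction`.
  have hb : (β_ (F.obj X) (F.obj (ᘁX : C))).hom ≫ coactRight (coact F (ᘁX : C)) (F.obj X) ≫
      EndPredual F ◁ (β_ (F.obj (ᘁX : C)) (F.obj X)).hom =
      coactLeft (F.obj X) (coact F (ᘁX : C)) := by
    rw [← braiding_coactLeft]
    simp [SymmetricCategory.symmetry_assoc, ← MonoidalCategory.whiskerLeft_comp]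
  refine (tensorRightHomEquiv_whiskerLeft_leftDualIso _ _ _).trans ?_
  rw [whiskerLeft_doubleDualIso_incl, MonoidalCategory.whiskerLeft_comp, Category.assoc,
    reassoc_of% hb]
  change _ = dualCoaction (coact F (ᘁX : C))
  simp only [tensorRightHomEquiv, Equiv.coe_fn_mk, dualCoaction, coactLeft, coactRight]
  monoidal

variable [MonoidalClosed V]

/-- The antipode of `End^∨(F)`. -/
noncomputable def antipodeMap : EndPredual F ⟶ EndPredual F :=
  (exists_lift_of_natural F (antipodeCoact F) fun _ _ g => antipodeCoact_natural F g).choose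

lemma coact_antipodeMap (X : C) : coact F X ≫ antipodeMap F ▷ F.obj X = antipodeCoact F X :=
  (exists_lift_of_natural F (antipodeCoact F)
    fun _ _ g => antipodeCoact_natural F g).choose_spec X

lemma incl_antipodeMap (X : C) : incl F X ≫ antipodeMap F = antipodeComponent F X := by
  rw [incl_comp, coact_antipodeMap, ← tensorRightHomEquiv_antipodeComponent,
    Equiv.symm_apply_apply]

/-- Naturality of `coact` applies because the coevaluation is a morphism of C; `ε F` and `δ F`
respect the coactions too. -/
lemma mapPairing_coevaluation_tensorCoact (X : C) :
    (mapPairing F (ᘁX : C) X).coevaluation' ≫ tensorCoact F (ᘁX : C) X =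
      unitCoact F ≫ EndPredual F ◁ (mapPairing F (ᘁX : C) X).coevaluation' := by
  simp only [mapPairing_coevaluation, Category.assoc, δ_tensorCoact, reassoc_of% coact_natural,
    reassoc_of% ε_coact F,
    MonoidalCategory.whiskerLeft_comp]

lemma mapPairing_evaluation_unitCoact (X : C) :
    (mapPairing F (ᘁX : C) X).evaluation' ≫ unitCoact F =
      tensorCoact F X (ᘁX : C) ≫ EndPredual F ◁ (mapPairing F (ᘁX : C) X).evaluation' := by
  simp only [mapPairing_evaluation, Category.assoc, η_unitCoact, reassoc_of% coact_natural,
    reassoc_of% μ_coact F,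
    MonoidalCategory.whiskerLeft_comp]

/-- Multiplication turns the tensor coaction after the coevaluation into `tensorCoact`; by `hη` this
becomes the unit coaction, and a triangle identity leaves only u. -/
lemma antipodeMap_left :
    comulMap F ≫ antipodeMap F ▷ EndPredual F ≫ mulMap F = counitMap F ≫ unitMap F := by
  refine (separating_coact F).hom_ext fun X => ?_
  let := mapPairing F (ᘁX : C) X
  have hη : η_ (F.obj (ᘁX : C)) (F.obj X) ≫ tensorCoact F (ᘁX : C) X =
      unitCoact F ≫ EndPredual F ◁ η_ (F.obj (ᘁX : C)) (F.obj X) :=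
    mapPairing_coevaluation_tensorCoact F X
  rw [coact_counitMap_unitMap, comp_whiskerRight, comp_whiskerRight, reassoc_of% coact_comulMap,
    ← reassoc_of% seqCoaction_comp_whiskerRight_left, coact_antipodeMap]
  change seqCoaction (dualCoaction (coact F (ᘁX : C))) _ ≫ _ = _
  rw [seqCoaction_dualCoaction_left]
  simp only [Category.assoc]
  rw [whisker_exchange, ← reassoc_of% coactLeft_comp_whiskerRight, tensorCoaction_mulMap,
    reassoc_of% coactLeft_naturality hη, unitCoact, coactLeft_rightUnitor_inv]
  simp only [Category.assoc, ← MonoidalCategory.whiskerLeft_comp, Iso.inv_hom_id_assoc,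
    ExactPairing.coevaluation_evaluation_assoc]
  simp

lemma antipodeMap_right :
    comulMap F ≫ EndPredual F ◁ antipodeMap F ≫ mulMap F = counitMap F ≫ unitMap F := by
  refine (separating_coact F).hom_ext fun X => ?_
  let := mapPairing F (ᘁX : C) X
  -- Here the evaluation absorbs the coaction, in place of the coevaluation.
  have hε : ε_ (F.obj (ᘁX : C)) (F.obj X) ≫ unitCoact F =
      tensorCoact F X (ᘁX : C) ≫ EndPredual F ◁ ε_ (F.obj (ᘁX : C)) (F.obj X) :=
    mapPairing_evaluation_unitCoact F X
  rw [coact_counitMap_unitMap, comp_whiskerRight, comp_whiskerRight, reassoc_of% coact_comulMap,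
    ← reassoc_of% seqCoaction_comp_whiskerRight_right, coact_antipodeMap]
  change seqCoaction _ (dualCoaction (coact F (ᘁX : C))) ≫ _ = _
  rw [seqCoaction_dualCoaction_right]
  simp only [Category.assoc]
  rw [whisker_exchange, ← reassoc_of% coactRight_comp_whiskerRight, tensorCoaction_mulMap,
    MonoidalCategory.whiskerLeft_comp, ← reassoc_of% coactRight_natural hε,
    ExactPairing.coevaluation_evaluation_assoc]
  simp only [unitCoact, coactRight]
  monoidal

/-- `End^∨(F)` is a Hopf algebra. -/
noncomputable abbrev hopfObj : HopfObj (EndPredual F) where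
  one := unitMap F
  mul := mulMap F
  one_mul := mulMap_one_left F
  mul_one := mulMap_one_right F
  mul_assoc := mulMap_assoc F
  counit := counitMap F
  comul := comulMap F
  counit_comul := comulMap_counitMap_left F
  comul_counit := comulMap_counitMap_right F
  comul_assoc := comulMap_assoc F
  mul_comul := mulMap_comulMap F
  one_comul := unitMap_comulMap F
  mul_counit := mulMap_counitMap F
  one_counit := unitMap_counitMap F
  antipode := antipodeMap F
  antipode_left := antipodeMap_left F
  antipode_right := antipodeMap_right F

end Antipode

end PredualEnd

theorem mainTheorem4
    {V : Type u} [Category.{v} V] [MonoidalCategory V] [SymmetricCategory V]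
    [HasColimitsOfSize.{w, w} V] [MonoidalClosed V]
    (P : ObjectProperty V) [P.IsMonoidal] [∀ A : P.FullSubcategory, HasLeftDual A.obj]
    {C : Type w} [SmallCategory C] [MonoidalCategory C] [LeftRigidCategory C]
    (F : C ⥤ P.FullSubcategory) [F.Monoidal] :
    ∃ H : HopfObj (EndPredual (F ⋙ P.ι)),
      (∀ X : C, incl (F ⋙ P.ι) X ≫ H.comul = comulComponent (F ⋙ P.ι) X) ∧
      (∀ X : C, incl (F ⋙ P.ι) X ≫ H.counit = counitComponent (F ⋙ P.ι) X) ∧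
      (∀ X Y : C, (incl (F ⋙ P.ι) X ⊗ₘ incl (F ⋙ P.ι) Y) ≫ H.mul =
        mulComponent (F ⋙ P.ι) X Y) ∧
      H.one = unitMap (F ⋙ P.ι) ∧
      (∀ X : C, incl (F ⋙ P.ι) X ≫ H.antipode = antipodeComponent (F ⋙ P.ι) X) :=
  ⟨hopfObj (F ⋙ P.ι), incl_comulMap _, incl_counitMap _, incl_mulMap _, rfl, incl_antipodeMap _⟩
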